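/- **Setting (distributed index coding).** Let $[n]=\{1,\dots,n\}$ and let $N$ be the set of nonempty subsets of $[n]$. There are messages $x_j\in\{0,1\}^{t_j}$, $j\in[n]$; receiver $j$ wants $x_j$ and knows $x_i$ for $i\in A_j$, where $A_j\subseteq[n]\setminus\{j\}$. For each $J\in N$ there is a server holding exactly the messages $x_i$, $i\in J$; it broadcasts to all receivers a string $y_J\in\{0,1\}^{u_J}$ that is a function of these messages, over a link of capacity $C_J\ge 0$. Receiver $j$ must recover $x_j$ exactly from all the $y_J$ and its side information, for all values of the messages. A rate tuple $(R_1,\dots,R_n)\in\mathbb R^n$ is *achievable* if for some block length $r\in\{1,2,\dots\}$ there is such a code with $R_j\le t_j/r$ for all $j\in[n]$ and $C_J\ge u_J/r$ for all $J\in N$. The *capacity region* $\mathscr C$ is the closure of the set of achievable rate tuples. **Group regions.** For a set of servers $P\subseteq N$ let $J'=\bigcup_{J\in P}J$ and $A_{j,P}=\bigcup_{J\in P}(A_j\cap J)$. Given numbers $C_{K,J}\ge0$ (composite rates) for $J\in P$ and $\emptyset\ne K\subseteq J$, let $\mathcal R(D\,|\,A_{j,P})$, for $D\subseteq J'$, be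 the set of $(R_{1,P},\dots,R_{n,P})\in\mathbb R^n$ such that $$\sum_{i\in L}R_{i,P}<\sum_{K\subseteq D\cup A_{j,P}:\,K\cap L\neq\emptyset}\ \ \sum_{J\in P:\,K\subseteq J}C_{K,J}\qquad\text{for all nonempty } L\subseteq D\setminus A_{j,P}.$$ Let $\mathscr R_P$ be the set of all $\mathbf R_P\in\mathbb R^n$ with $R_{j,P}=0$ for $j\notin J'$ such that, for some composite rates $C_{K,J}\ge 0$ with $$\sum_{K\subseteq J:\,K\not\subseteq A_j}C_{K,J}\le C_J\qquad\text{for all } j\in J',\ J\in P,$$ one has $$\mathbf R_P\in\bigcap_{j\in J'}\ \bigcup_{D_{j,P}\subseteq J':\,j\in D_{j,P}}\mathcal R(D_{j,P}\,|\,A_{j,P}).$$ **Theorem.** Let $\mathcal G$ be any family of pairwise disjoint sets of servers (for example, any partition of $N$). 1. Every rate tuple of the form $\mathbf R=\sum_{P\in\mathcal G}\mathbf R_P$ with $\mathbf R_P\in\mathscr R_P$ for all $P\in\mathcal G$ is achievable. In particular, the closure of the set of these tuples is contained in $\mathscr C$. 2. If $\mathcal G=\{\{J\}:J\in N\}$,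 the set of these tuples equals the inner bound that combines centralized composite coding over the servers, that is, the set of all $\sum_{J\in N}\mathbf R_J$ such that, for each $J\in N$, $R_{j,J}=0$ for $j\notin J$ and there are $C_{K,J}\ge0$ ($\emptyset\ne K\subseteq J$) with $\sum_{K\subseteq J:\,K\not\subseteq A_j}C_{K,J}\le C_J$ for all $j\in J$, and, for every $j\in J$, a set $D_{j,J}\subseteq J$ containing $j$ with $$\sum_{i\in L}R_{i,J}<\sum_{K\subseteq D_{j,J}\cup(A_j\cap J):\,K\cap L\ne\emptyset}C_{K,J}\qquad\text{for all nonempty } L\subseteq D_{j,J}\setminus A_j.$$ 3. If $\mathcal G=\{N\}$, the set of these tuples equals the inner bound of distributed composite coding with the same decoding sets at all servers, that is, the set of all $\mathbf R\in\mathbb R^n$ such that there are $C_{K,J}\ge0$ ($J\in N$, $\emptyset\ne K\subseteq J$) with $\sum_{K\subseteq J:\,K\not\subseteq A_j}C_{K,J}\le C_J$ for all $j\in[n]$, $J\in N$, and, for every $j\in[n]$, a set $D_j\subseteq[n]$ containing $j$ with $$\sum_{i\in L}R_i<\sum_{K\subseteq D_j\cup A_j:\,K\cap L\ne\emptyset}\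 \ \sum_{J\in N:\,K\subseteq J}C_{K,J}\qquad\text{for all nonempty } L\subseteq D_j\setminus A_j.$$ -/

import Mathlib

noncomputable section

namespace DistIndexCoding

/-- Servers are indexed by the nonempty subsets `J` of the message set; server `J` holds exactly
the messages with index in `J`. -/
abbrev Server (n : ℕ) : Type := {J : Finset (Fin n) // J.Nonempty}

/-- A family of message values: message `i` is a string of `t i` bits. -/
abbrev Messages {n : ℕ} (t : Fin n → ℕ) : Type := (i : Fin n) → Fin (t i) → Bool

/-- The values of the messages with index in `S`. -/
abbrev SubMessages {n : ℕ} (t : Fin n → ℕ) (S : Finset (Fin n)) : Type :=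
  (i : {i : Fin n // i ∈ S}) → Fin (t i.1) → Bool

/-- The part of a message family that is indexed by `S`. -/
def restrictTo {n : ℕ} {t : Fin n → ℕ} (x : Messages t) (S : Finset (Fin n)) : SubMessages t S :=
  fun i => x i.1

/-- A distributed index code with message lengths `t` and server output lengths `u`, for the
side information sets `A`: server `J` sends `u J` bits that are a function of the messages it
holds, receiver `j` maps all server outputs and the messages in `A j` to an estimate of message
`j`, and the estimate is correct for every choice of the messages. -/
structure IndexCode {n : ℕ} (A : Fin n → Finset (Fin n)) (t : Fin n → ℕ)
    (u : Server n → ℕ) where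
  enc : (J : Server n) → SubMessages t J.1 → (Fin (u J) → Bool)
  dec : (j : Fin n) → ((J : Server n) → Fin (u J) → Bool) → SubMessages t (A j) →
    (Fin (t j) → Bool)
  correct : ∀ (x : Messages t) (j : Fin n),
    dec j (fun J => enc J (restrictTo x J.1)) (restrictTo x (A j)) = x j

/-- The rate tuple `R` is achievable for the link capacities `C`: for some block length `r` there
is an index code with `R j ≤ t j / r` and `u J / r ≤ C J`. -/
def Achievable {n : ℕ} (A : Fin n → Finset (Fin n)) (C : Server n → ℝ) (R : Fin n → ℝ) : Prop :=
  ∃ (r : ℕ) (t : Fin n → ℕ) (u : Server n → ℕ), 0 < r ∧ Nonempty (IndexCode A t u) ∧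
    (∀ j, R j ≤ (t j : ℝ) / (r : ℝ)) ∧ (∀ J, (u J : ℝ) / (r : ℝ) ≤ C J)

/-- The capacity region: the closure of the set of achievable rate tuples. -/
def capacityRegion {n : ℕ} (A : Fin n → Finset (Fin n)) (C : Server n → ℝ) :
    Set (Fin n → ℝ) :=
  closure {R | Achievable A C R}

/-! ### Grouped servers, different decoding sets -/

/-- The union of all message sets held by the servers of the group `P`. -/
def held {n : ℕ} (P : Finset (Server n)) : Finset (Fin n) := P.biUnion fun J => J.1

/-- The side information of a receiver within the group `P`: the union over `J ∈ P` of `S ∩ J`. -/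
def groupSide {n : ℕ} (S : Finset (Fin n)) (P : Finset (Server n)) : Finset (Fin n) :=
  P.biUnion fun J => S ∩ J.1

/-- The polymatroidal region `R(D | S)` for the group `P`, where `c K J` is the rate of the
composite message `K ⊆ J` at server `J`. -/
def groupPoly {n : ℕ} (P : Finset (Server n)) (c : Finset (Fin n) → Server n → ℝ)
    (D S : Finset (Fin n)) : Set (Fin n → ℝ) :=
  {R | ∀ L : Finset (Fin n), L ⊆ D \ S → L.Nonempty →
    ∑ j ∈ L, R j < ∑ K ∈ (D ∪ S).powerset with (K ∩ L).Nonempty,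
      ∑ J ∈ P with K ⊆ J.1, c K J}

/-- The composite coding region of the group `P`: there are nonnegative composite rates meeting
the link constraints of the servers in `P` such that `R j = 0` for `j` outside `held P` and `R`
lies in the intersection over `j ∈ held P` of the union over the decoding sets `D` of receiver `j`
of the polymatroidal regions. -/
def groupRegion {n : ℕ} (A : Fin n → Finset (Fin n)) (C : Server n → ℝ)
    (P : Finset (Server n)) : Set (Fin n → ℝ) :=
  {R | ∃ c : Finset (Fin n) → Server n → ℝ,
    (∀ J ∈ P, ∀ K ⊆ J.1, K.Nonempty → 0 ≤ c K J) ∧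
    (∀ j ∈ held P, ∀ J ∈ P, ∑ K ∈ J.1.powerset with ¬ K ⊆ A j, c K J ≤ C J) ∧
    (∀ j, j ∉ held P → R j = 0) ∧
    R ∈ ⋂ j ∈ held P, ⋃ D : Finset (Fin n), ⋃ _ : D ⊆ held P ∧ j ∈ D,
      groupPoly P c D (groupSide (A j) P)}

/-- The inner bound for a family `G` of server groups: sums over the groups of rate tuples in the
composite coding regions of the groups. -/
def groupInnerBound {n : ℕ} (A : Fin n → Finset (Fin n)) (C : Server n → ℝ)
    (G : Finset (Finset (Server n))) : Set (Fin n → ℝ) :=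
  {R | ∃ ρ : Finset (Server n) → Fin n → ℝ,
    (∀ P ∈ G, ρ P ∈ groupRegion A C P) ∧ R = ∑ P ∈ G, ρ P}

/-! ### Centralized composite coding separately at each server -/

/-- The polymatroidal region `R(D | S)` for a single server with composite rates `c`. -/
def serverPoly {n : ℕ} (c : Finset (Fin n) → ℝ) (D S : Finset (Fin n)) : Set (Fin n → ℝ) :=
  {R | ∀ L : Finset (Fin n), L ⊆ D \ S → L.Nonempty →
    ∑ j ∈ L, R j < ∑ K ∈ (D ∪ S).powerset with (K ∩ L).Nonempty, c K}

/-- The composite coding region of server `J` on its own. -/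
def serverRegion {n : ℕ} (A : Fin n → Finset (Fin n)) (C : Server n → ℝ) (J : Server n) :
    Set (Fin n → ℝ) :=
  {R | ∃ c : Finset (Fin n) → ℝ,
    (∀ K ⊆ J.1, K.Nonempty → 0 ≤ c K) ∧
    (∀ j ∈ J.1, ∑ K ∈ J.1.powerset with ¬ K ⊆ A j, c K ≤ C J) ∧
    (∀ j, j ∉ J.1 → R j = 0) ∧
    R ∈ ⋂ j ∈ J.1, ⋃ D : Finset (Fin n), ⋃ _ : D ⊆ J.1 ∧ j ∈ D,
      serverPoly c D (A j ∩ J.1)}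

/-- The inner bound from combining the centralized composite coding regions of all servers. -/
def separateInnerBound {n : ℕ} (A : Fin n → Finset (Fin n)) (C : Server n → ℝ) :
    Set (Fin n → ℝ) :=
  {R | ∃ ρ : Server n → Fin n → ℝ, (∀ J, ρ J ∈ serverRegion A C J) ∧ R = ∑ J, ρ J}

/-! ### Distributed composite coding with the same decoding sets at all servers -/

/-- The polymatroidal region `R(D | S)` for all servers treated collectively. -/
def commonPoly {n : ℕ} (c : Finset (Fin n) → Server n → ℝ) (D S : Finset (Fin n)) :
    Set (Fin n → ℝ) :=
  {R | ∀ L : Finset (Fin n), L ⊆ D \ S → L.Nonempty →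
    ∑ j ∈ L, R j < ∑ K ∈ (D ∪ S).powerset with (K ∩ L).Nonempty,
      ∑ J : Server n with K ⊆ J.1, c K J}

/-- The inner bound from distributed composite coding with one decoding set per receiver. -/
def commonInnerBound {n : ℕ} (A : Fin n → Finset (Fin n)) (C : Server n → ℝ) :
    Set (Fin n → ℝ) :=
  {R | ∃ c : Finset (Fin n) → Server n → ℝ,
    (∀ J : Server n, ∀ K ⊆ J.1, K.Nonempty → 0 ≤ c K J) ∧
    (∀ (j : Fin n) (J : Server n), ∑ K ∈ J.1.powerset with ¬ K ⊆ A j, c K J ≤ C J) ∧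
    R ∈ ⋂ j, ⋃ D : Finset (Fin n), ⋃ _ : j ∈ D, commonPoly c D (A j)}

/-- The grouping in which every server forms a group of its own. -/
def singletonGroups (n : ℕ) : Finset (Finset (Server n)) :=
  Finset.univ.image fun J : Server n => ({J} : Finset (Server n))

/-- The grouping in which all servers form one group. -/
def oneGroup (n : ℕ) : Finset (Finset (Server n)) := {Finset.univ}

end DistIndexCoding

end

namespace DistIndexCoding

open Finset

/-! Achievability is random linear coding over `ZMod 2` with a union bound. A group's code has two
layers: composite bits, random combinations of the bits of the messages in K, and a random linear
compression of these bits at each server. By linearity a receiver fails only if a nonzero difference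
vector, zero on its side information, is annihilated. If the messages where it is nonzero form L,
each composite bit with K meeting L annihilates it with probability 1/2, so the polymatroidal
inequality for L beats the number of such differences. Both layers come from
`exists_separating_matrix` and are combined in `exists_isDecodable`. The strict inequalities allow
all composite rates to be scaled by some δ < 1. For large block lengths this pays for rounding and
for the constants of the union bounds (`eventually_exists_isDecodable`). Codes of disjoint groups
are then concatenated at a common block length; each link serves at most one group. The two special
groupings only require unfolding the regions. -/

/-! ### Counting for random matrices over `ZMod 2` -/

/-- A vector that is nonzero somewhere on `S` is annihilated, on `S`, by at most half of all
vectors over `ZMod 2`. -/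
theorem two_mul_card_annihilator_le {X : Type*} [Fintype X] [DecidableEq X] (S : Finset X)
    (z : X → ZMod 2) (h : ∃ x ∈ S, z x ≠ 0) :
    2 * #{m : X → ZMod 2 | ∑ x ∈ S, m x * z x = 0} ≤ Fintype.card (X → ZMod 2) := by
  obtain ⟨y, hy, hz⟩ := h
  have hle : #{m : X → ZMod 2 | ∑ x ∈ S, m x * z x = 0} ≤
      #{m : X → ZMod 2 | ¬ ∑ x ∈ S, m x * z x = 0} := by
    -- Flipping the coordinate `y` of `m` changes the sum by `z y ≠ 0`, so it maps annihilators
    -- injectively to non-annihilators.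
    refine Finset.card_le_card_of_injOn (fun m => m + Pi.single y 1) ?_
      (add_left_injective _).injOn
    intro m hm
    simp only [coe_filter, mem_univ, true_and, Set.mem_ofPred_eq] at hm ⊢
    simp only [Pi.add_apply, add_mul, sum_add_distrib, hm, zero_add, Pi.single_apply, ite_mul,
      one_mul, zero_mul, sum_ite_eq', hy, if_true]
    exact hz
  have := Finset.card_filter_add_card_filter_not (s := (univ : Finset (X → ZMod 2)))
    (fun m => ∑ x ∈ S, m x * z x = 0)
  rw [Finset.card_univ] at this
  omega

/-- The fraction of matrices whose rows in `F` all annihilate `z` is at most `2 ^ (-k)`, when at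
least `k` of these rows see the support of `z`. -/
theorem two_pow_mul_card_annihilating_le {X E : Type*} [Fintype X] [DecidableEq X] [Fintype E]
    [DecidableEq E] (S : E → Finset X) (F : Finset E) (z : X → ZMod 2) (k : ℕ)
    (hk : k ≤ #{e ∈ F | ∃ x ∈ S e, z x ≠ 0}) :
    2 ^ k * #{M : E → X → ZMod 2 | ∀ e ∈ F, ∑ x ∈ S e, M e x * z x = 0} ≤
      Fintype.card (E → X → ZMod 2) := by
  -- The rows are chosen independently: a row in `F` that sees `z` is confined to at most half of
  -- its choices, any other row is left free.
  let s : E → Finset (X → ZMod 2) := fun e =>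
    if e ∈ F ∧ ∃ x ∈ S e, z x ≠ 0 then
      ({m | ∑ x ∈ S e, m x * z x = 0} : Finset (X → ZMod 2)) else univ
  have hsub : ({M : E → X → ZMod 2 | ∀ e ∈ F, ∑ x ∈ S e, M e x * z x = 0} : Finset _) ⊆
      Fintype.piFinset s := by
    intro M hM
    simp only [mem_filter, mem_univ, true_and] at hM
    simp only [Fintype.mem_piFinset, s]
    intro e
    split_ifs with h
    · simpa using hM e h.1
    · simp
  have hpow : 2 ^ #{e ∈ F | ∃ x ∈ S e, z x ≠ 0} =
      ∏ e, if e ∈ F ∧ ∃ x ∈ S e, z x ≠ 0 then 2 else 1 := by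
    rw [Finset.prod_ite]
    simp only [prod_const, one_pow, mul_one]
    congr 2
    ext e
    simp
  calc 2 ^ k * #{M : E → X → ZMod 2 | ∀ e ∈ F, ∑ x ∈ S e, M e x * z x = 0}
      ≤ 2 ^ #{e ∈ F | ∃ x ∈ S e, z x ≠ 0} * #(Fintype.piFinset s) :=
        Nat.mul_le_mul (Nat.pow_le_pow_right (by norm_num) hk) (card_le_card hsub)
    _ = ∏ e, (if e ∈ F ∧ ∃ x ∈ S e, z x ≠ 0 then 2 else 1) * #(s e) := by
        rw [hpow, Fintype.card_piFinset, prod_mul_distrib]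
    _ ≤ ∏ _e : E, Fintype.card (X → ZMod 2) := by
        refine Finset.prod_le_prod' fun e _ => ?_
        simp only [s]
        split_ifs with h
        · exact two_mul_card_annihilator_le _ _ h.2
        · simp
    _ = Fintype.card (E → X → ZMod 2) := by
        rw [Fintype.card_fun (α := E)]; simp

/-- Random linear coding: when the sets `Z a` are small compared with the number of rows in `F a`
that see the support of each of their elements, some matrix, whose row `e` has its support
in `S e`, annihilates none of these elements on the rows in `F a`. -/
theorem exists_separating_matrix {X E α : Type*} [Fintype X] [DecidableEq X] [Fintype E]
    [DecidableEq E] [Fintype α] (S : E → Finset X) (F : α → Finset E)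
    (Z : α → Finset (X → ZMod 2)) (k : α → ℕ)
    (hk : ∀ a, ∀ z ∈ Z a, k a ≤ #{e ∈ F a | ∃ x ∈ S e, z x ≠ 0})
    (hZ : ∀ a, Fintype.card α * #(Z a) < 2 ^ k a) :
    ∃ M : E → X → ZMod 2, ∀ a, ∀ z ∈ Z a, ∃ e ∈ F a, ∑ x ∈ S e, M e x * z x ≠ 0 := by
  classical
  by_contra! hbad
  have : Nonempty α := ⟨(hbad 0).choose⟩
  have hcover : (univ : Finset (E → X → ZMod 2)) ⊆ univ.biUnion fun a => (Z a).biUnion fun z =>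
      {M : E → X → ZMod 2 | ∀ e ∈ F a, ∑ x ∈ S e, M e x * z x = 0} := by
    intro M _
    obtain ⟨a, z, hz, h⟩ := hbad M
    simp only [mem_biUnion, mem_univ, true_and, mem_filter]
    exact ⟨a, z, hz, h⟩
  set W := Fintype.card (E → X → ZMod 2) with hW
  have hWpos : (0 : ℝ) < W := by
    rw [hW]; exact_mod_cast Fintype.card_pos
  have hαpos : (0 : ℝ) < Fintype.card α := by exact_mod_cast Fintype.card_pos
  have h1 : (W : ℝ) ≤ ∑ a, ∑ z ∈ Z a,
      (#{M : E → X → ZMod 2 | ∀ e ∈ F a, ∑ x ∈ S e, M e x * z x = 0} : ℝ) := by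
    have := (card_le_card hcover).trans (card_biUnion_le.trans
      (sum_le_sum fun a _ => card_biUnion_le))
    rw [card_univ] at this
    exact_mod_cast this
  -- Union bound: `a` spoils at most `#(Z a) * W / 2 ^ k a` matrices, less than its share `W / card
  -- α`, so not every matrix is spoiled.
  have h2 : ∀ a, ∑ z ∈ Z a,
      (#{M : E → X → ZMod 2 | ∀ e ∈ F a, ∑ x ∈ S e, M e x * z x = 0} : ℝ) <
        W / Fintype.card α := by
    intro a
    have hb : ∀ z ∈ Z a,
        (#{M : E → X → ZMod 2 | ∀ e ∈ F a, ∑ x ∈ S e, M e x * z x = 0} : ℝ) ≤ W / 2 ^ k a := by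
      intro z hz
      rw [le_div_iff₀ (by positivity), mul_comm]
      exact_mod_cast two_pow_mul_card_annihilating_le S (F a) z (k a) (hk a z hz)
    refine (sum_le_sum hb).trans_lt ?_
    rw [sum_const, nsmul_eq_mul, lt_div_iff₀ hαpos, mul_div_assoc', div_mul_eq_mul_div,
      div_lt_iff₀ (by positivity)]
    have : (Fintype.card α * #(Z a) : ℝ) < 2 ^ k a := by exact_mod_cast hZ a
    nlinarith
  have h3 := sum_lt_sum_of_nonempty univ_nonempty fun a (_ : a ∈ (univ : Finset α)) => h2 a
  rw [sum_const, card_univ, nsmul_eq_mul, mul_div_cancel₀ _ hαpos.ne'] at h3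
  exact h1.not_gt h3

/-- Vectors over `ZMod 2` supported in `s` number at most `2 ^ #s`. -/
theorem card_supported_le {X : Type*} [Fintype X] [DecidableEq X] (s : Finset X) :
    #{z : X → ZMod 2 | ∀ x, z x ≠ 0 → x ∈ s} ≤ 2 ^ #s := by
  have : #{z : X → ZMod 2 | ∀ x, z x ≠ 0 → x ∈ s} ≤
      #(univ : Finset (s → ZMod 2)) := by
    refine card_le_card_of_injOn (fun z x => z x) (fun _ _ => mem_coe.mpr (mem_univ _)) ?_
    intro z hz z' hz' h
    simp only [coe_filter, mem_univ, true_and, Set.mem_ofPred_eq] at hz hz'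
    funext x
    by_cases hx : x ∈ s
    · exact congrFun h ⟨x, hx⟩
    · rw [not_not.mp (mt (hz x) hx), not_not.mp (mt (hz' x) hx)]
  refine this.trans ?_
  simp [ZMod.card]

/-! ### From encoders over `ZMod 2` to index codes -/

/-- Encoders `f`, for messages and server outputs that are vectors over `ZMod 2` with arbitrary
finite index types, from which every receiver can recover its message: the output of server `J`
depends on the messages in `J` only, and it determines, together with the messages in `A j` and
the other outputs, message `j`. -/
structure IsDecodable {n : ℕ} (A : Fin n → Finset (Fin n)) {T : Fin n → Type}
    {U : Server n → Type} (f : (J : Server n) → ((i : Fin n) → T i → ZMod 2) → U J → ZMod 2) :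
    Prop where
  eq_of_agree : ∀ J x x', (∀ i ∈ J.1, x i = x' i) → f J x = f J x'
  determines : ∀ x x' j, (∀ i ∈ A j, x i = x' i) → (∀ J, f J x = f J x') → x j = x' j

/-- The decoder picks any message family consistent with what the receiver sees; `determines` makes
its choice of message `j` correct. A server fills the messages it lacks with zeros, which
`eq_of_agree` makes harmless. -/
theorem IsDecodable.nonempty_indexCode {n : ℕ} {A : Fin n → Finset (Fin n)} {T : Fin n → Type}
    {U : Server n → Type} {f : (J : Server n) → ((i : Fin n) → T i → ZMod 2) → U J → ZMod 2}
    (hf : IsDecodable A f) {t : Fin n → ℕ} {u : Server n → ℕ} (eT : ∀ i, T i ≃ Fin (t i))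
    (eU : ∀ J, U J ≃ Fin (u J)) : Nonempty (IndexCode A t u) := by
  classical
  let β : ZMod 2 ≃ Bool := finTwoEquiv
  let ext : (S : Finset (Fin n)) → SubMessages t S → (i : Fin n) → T i → ZMod 2 :=
    fun S s i b => if h : i ∈ S then β.symm (s ⟨i, h⟩ (eT i b)) else 0
  let vec : Messages t → (i : Fin n) → T i → ZMod 2 := fun x i b => β.symm (x i (eT i b))
  let enc : (J : Server n) → SubMessages t J.1 → (Fin (u J) → Bool) :=
    fun J s b => β (f J (ext J.1 s) ((eU J).symm b))
  have henc : ∀ x J b, enc J (restrictTo x J.1) b = β (f J (vec x) ((eU J).symm b)) := by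
    intro x J b
    have : f J (ext J.1 (restrictTo x J.1)) = f J (vec x) := by
      refine hf.eq_of_agree _ _ _ fun i hi => ?_
      funext b
      simp [ext, vec, hi, restrictTo]
    simp only [enc, this]
  have hinj : ∀ x x' j, (∀ i ∈ A j, x i = x' i) →
      (∀ J, enc J (restrictTo x J.1) = enc J (restrictTo x' J.1)) → x j = x' j := by
    intro x x' j h1 h2
    have h := hf.determines (vec x) (vec x') j (fun i hi => by simp [vec, h1 i hi]) fun J => by
      funext b
      have := congrFun (h2 J) (eU J b)
      simpa [henc] using this
    funext b
    have := congrFun h ((eT j).symm b)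
    simpa [vec] using this
  refine ⟨⟨enc, fun j y s => if h : ∃ x : Messages t,
    (∀ J, enc J (restrictTo x J.1) = y J) ∧ restrictTo x (A j) = s then h.choose j
      else fun _ => false, ?_⟩⟩
  intro x j
  have h : ∃ x' : Messages t, (∀ J, enc J (restrictTo x' J.1) = enc J (restrictTo x J.1)) ∧
      restrictTo x' (A j) = restrictTo x (A j) := ⟨x, fun _ => rfl, rfl⟩
  rw [dif_pos h]
  exact hinj _ _ j (fun i hi => congrFun h.choose_spec.2 ⟨i, hi⟩) h.choose_spec.1


/-! ### Composite bits and their compression -/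

theorem card_filter_sigma_fin {ι : Type*} [Fintype ι] (m : ι → ℕ) (q : ι → Prop)
    [DecidablePred q] : #{e : Σ a, Fin (m a) | q e.1} = ∑ a with q a, m a := by
  rw [card_filter, Fintype.sum_sigma, sum_filter]
  refine sum_congr rfl fun a _ => ?_
  by_cases h : q a <;> simp [h]

/-- The composite bits at all servers: `m K J` random linear combinations of the bits of the
messages in `K` for each composite message `K` and server `J`. A receiver `j ∈ H` that knows the
messages in `B j` and the composite bits of the `K ⊆ D j ∪ B j` can recover the messages
in `D j`. -/
theorem exists_compositeCode {n : ℕ} (H : Finset (Fin n)) (B D : Fin n → Finset (Fin n))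
    (t : Fin n → ℕ) (m : Finset (Fin n) → Server n → ℕ)
    (ht : ∀ j ∈ H, ∀ L ⊆ D j \ B j, L.Nonempty → (∀ i ∈ L, 0 < t i) →
      ∑ i ∈ L, t i + 2 * n ≤ ∑ K ∈ (D j ∪ B j).powerset with (K ∩ L).Nonempty, ∑ J, m K J) :
    ∃ M : (Σ p : Finset (Fin n) × Server n, Fin (m p.1 p.2)) → (Σ i, Fin (t i)) → ZMod 2,
      ∀ j ∈ H, ∀ z : (i : Fin n) → Fin (t i) → ZMod 2, (∀ i ∈ B j, z i = 0) →
        (∀ e : Σ p : Finset (Fin n) × Server n, Fin (m p.1 p.2), e.1.1 ⊆ D j ∪ B j →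
          ∑ y with y.1 ∈ e.1.1, M e y * z y.1 y.2 = 0) → ∀ i ∈ D j, z i = 0 := by
  classical
  obtain ⟨M, hM⟩ := exists_separating_matrix
    (X := Σ i, Fin (t i)) (E := Σ p : Finset (Fin n) × Server n, Fin (m p.1 p.2))
    (α := Fin n × Finset (Fin n))
    (fun e => {y | y.1 ∈ e.1.1})
    (fun a => {e | e.1.1 ⊆ D a.1 ∪ B a.1})
    -- Differences are sorted by the exact set `L` of messages on which they are nonzero, so that a
    -- composite bit of `K` sees such a difference if and only if `K` meets `L`.
    (fun a => if a.1 ∈ H ∧ a.2 ⊆ D a.1 \ B a.1 ∧ a.2.Nonempty then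
      ({z | (∀ y, z y ≠ 0 → y.1 ∈ a.2) ∧ ∀ i ∈ a.2, ∃ b, z ⟨i, b⟩ ≠ 0} :
        Finset ((Σ i, Fin (t i)) → ZMod 2)) else ∅)
    (fun a => ∑ K ∈ (D a.1 ∪ B a.1).powerset with (K ∩ a.2).Nonempty, ∑ J, m K J)
    (by
      rintro ⟨j, L⟩ z hz
      dsimp only at hz ⊢
      split_ifs at hz with h
      swap
      · simp at hz
      simp only [mem_filter, mem_univ, true_and] at hz
      have heq : ({e ∈ ({e | e.1.1 ⊆ D j ∪ B j} :
            Finset (Σ p : Finset (Fin n) × Server n, Fin (m p.1 p.2))) |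
          ∃ x ∈ ({y | y.1 ∈ e.1.1} : Finset (Σ i, Fin (t i))), z x ≠ 0}) =
          ({e | e.1.1 ⊆ D j ∪ B j ∧ (e.1.1 ∩ L).Nonempty} : Finset _) := by
        ext e
        simp only [mem_filter, mem_univ, true_and]
        refine and_congr_right fun _ => ⟨?_, ?_⟩
        · rintro ⟨y, hy, hne⟩
          exact ⟨y.1, mem_inter.mpr ⟨hy, hz.1 y hne⟩⟩
        · rintro ⟨i, hi⟩
          obtain ⟨b, hb⟩ := hz.2 i (mem_inter.mp hi).2
          exact ⟨⟨i, b⟩, (mem_inter.mp hi).1, hb⟩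
      rw [heq, card_filter_sigma_fin (fun p : Finset (Fin n) × Server n => m p.1 p.2)
        (fun p => p.1 ⊆ D j ∪ B j ∧ (p.1 ∩ L).Nonempty), ← sum_product']
      refine sum_le_sum_of_subset fun p hp => ?_
      simpa only [mem_product, mem_filter, mem_powerset, mem_univ, true_and, and_true] using hp)
    (by
      rintro ⟨j, L⟩
      dsimp only
      split_ifs with h
      swap
      · simp
      rcases Finset.eq_empty_or_nonempty ({z | (∀ y, z y ≠ 0 → y.1 ∈ L) ∧
        ∀ i ∈ L, ∃ b, z ⟨i, b⟩ ≠ 0} : Finset ((Σ i, Fin (t i)) → ZMod 2)) with h0 | ⟨z, hz⟩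
      · simp [h0]
      simp only [mem_filter, mem_univ, true_and] at hz
      have hpos : ∀ i ∈ L, 0 < t i := fun i hi => (hz.2 i hi).choose.pos
      have hcard : #({z | (∀ y, z y ≠ 0 → y.1 ∈ L) ∧ ∀ i ∈ L, ∃ b, z ⟨i, b⟩ ≠ 0} :
          Finset ((Σ i, Fin (t i)) → ZMod 2)) ≤ 2 ^ ∑ i ∈ L, t i := by
        have h1 := card_supported_le ({y | y.1 ∈ L} : Finset (Σ i, Fin (t i)))
        rw [card_filter_sigma_fin t (fun i => i ∈ L), filter_univ_mem] at h1
        refine (card_le_card fun z hz => ?_).trans h1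
        simp only [mem_filter, mem_univ, true_and] at hz ⊢
        exact hz.1
      -- The slack `2 * n` in `ht` pays for the union bound over all pairs of a receiver and a set
      -- `L`: there are `n * 2 ^ n` of them.
      have hα : Fintype.card (Fin n × Finset (Fin n)) < 2 ^ (2 * n) := by
        rw [Fintype.card_prod, Fintype.card_finset, Fintype.card_fin, two_mul, pow_add]
        exact Nat.mul_lt_mul_of_pos_right Nat.lt_two_pow_self (by positivity)
      calc _ ≤ Fintype.card (Fin n × Finset (Fin n)) * 2 ^ ∑ i ∈ L, t i :=
            Nat.mul_le_mul_left _ hcard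
        _ < 2 ^ (2 * n) * 2 ^ ∑ i ∈ L, t i := Nat.mul_lt_mul_of_pos_right hα (by positivity)
        _ = 2 ^ (∑ i ∈ L, t i + 2 * n) := by rw [pow_add, mul_comm]
        _ ≤ _ := Nat.pow_le_pow_right (by norm_num) (ht j h.1 L h.2.1 h.2.2 hpos))
  refine ⟨M, fun j hj z hz hw => ?_⟩
  -- `z` may be nonzero outside `D j ∪ B j`. Truncating it to `D j` does not change the composite
  -- bits with `K ⊆ D j ∪ B j`, since `z` vanishes on `B j`.
  let z' : (Σ i, Fin (t i)) → ZMod 2 := fun y => if y.1 ∈ D j then z y.1 y.2 else 0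
  let L : Finset (Fin n) := {i ∈ D j | z i ≠ 0}
  by_contra! hne
  obtain ⟨i, hi, hi0⟩ := hne
  have hcond : j ∈ H ∧ L ⊆ D j \ B j ∧ L.Nonempty := by
    refine ⟨hj, fun i hi => ?_, i, mem_filter.mpr ⟨hi, hi0⟩⟩
    obtain ⟨h1, h2⟩ := mem_filter.mp hi
    exact mem_sdiff.mpr ⟨h1, fun h => h2 (hz i h)⟩
  obtain ⟨e, he, hsum⟩ := hM (j, L) z' (by
    rw [if_pos hcond]
    simp only [mem_filter, mem_univ, true_and, z', L]
    refine ⟨fun y hy => ?_, fun i hi => ?_⟩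
    · split_ifs at hy with h
      · exact ⟨h, fun h0 => hy (by rw [h0]; rfl)⟩
      · exact absurd rfl hy
    · obtain ⟨b, hb⟩ := Function.ne_iff.mp hi.2
      exact ⟨b, by simpa [hi.1] using hb⟩)
  simp only [mem_filter, mem_univ, true_and] at he
  refine hsum ?_
  rw [← hw e he]
  refine sum_congr rfl fun y hy => ?_
  congr 1
  simp only [z']
  split_ifs with h
  · rfl
  · have := mem_union.mp (he (mem_filter.mp hy).2)
    rw [hz _ (this.resolve_left h)]
    rfl

/-- The compression of the composite bits at a server into `u` bits: receiver `j`, who lacks the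
bits in `Y j`, can recover these. -/
theorem exists_linkCode {n : ℕ} {X : Type*} [Fintype X] [DecidableEq X] (H : Finset (Fin n))
    (Y : Fin n → Finset X) (u : ℕ) (hu : ∀ j ∈ H, #(Y j) = 0 ∨ #(Y j) + n ≤ u) :
    ∃ N : Fin u → X → ZMod 2, ∀ j ∈ H, ∀ v : X → ZMod 2, (∀ y, v y ≠ 0 → y ∈ Y j) →
      (∀ b, ∑ y, N b y * v y = 0) → v = 0 := by
  classical
  obtain ⟨N, hN⟩ := exists_separating_matrix (X := X) (E := Fin u) (α := Fin n)
    (fun _ => univ) (fun _ => univ)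
    (fun j => if j ∈ H then
      ({v | (∀ y, v y ≠ 0 → y ∈ Y j) ∧ v ≠ 0} : Finset (X → ZMod 2)) else ∅) (fun _ => u)
    (by
      intro j v hv
      split_ifs at hv with h
      swap
      · simp at hv
      simp only [mem_filter, mem_univ, true_and] at hv
      obtain ⟨y, hy⟩ := Function.ne_iff.mp hv.2
      have : ∃ x, v x ≠ 0 := ⟨y, hy⟩
      simp [this])
    (by
      intro j
      split_ifs with h
      swap
      · simp
      -- The slack `n` pays for the union bound over receivers. With no unknown bits there is
      -- nothing to separate, which lets links of capacity zero pass.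
      rcases hu j h with h0 | h0
      · have : ({v | (∀ y, v y ≠ 0 → y ∈ Y j) ∧ v ≠ 0} : Finset (X → ZMod 2)) = ∅ := by
          rw [card_eq_zero] at h0
          simp only [h0, filter_eq_empty_iff, mem_univ, not_and, true_imp_iff]
          intro v hv hv0
          exact hv0 (funext fun y => not_not.mp fun hy => notMem_empty _ (hv y hy))
        simp [this]
      · have hcard : #({v | (∀ y, v y ≠ 0 → y ∈ Y j) ∧ v ≠ 0} : Finset (X → ZMod 2)) ≤
            2 ^ #(Y j) := by
          refine (card_le_card fun v hv => ?_).trans (card_supported_le (Y j))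
          simp only [mem_filter, mem_univ, true_and] at hv ⊢
          exact hv.1
        rw [Fintype.card_fin]
        calc _ ≤ n * 2 ^ #(Y j) := Nat.mul_le_mul_left _ hcard
          _ < 2 ^ n * 2 ^ #(Y j) :=
            Nat.mul_lt_mul_of_pos_right Nat.lt_two_pow_self (by positivity)
          _ = 2 ^ (#(Y j) + n) := by rw [pow_add, mul_comm]
          _ ≤ 2 ^ u := Nat.pow_le_pow_right (by norm_num) h0)
  refine ⟨N, fun j hj v hv h => ?_⟩
  by_contra hne
  obtain ⟨b, -, hb⟩ := hN j v (by
    rw [if_pos hj]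
    exact mem_filter.mpr ⟨mem_univ _, hv, hne⟩)
  exact hb (h b)

/-- Composite coding with integer composite lengths `m K J`: the composite bits are generated by
random linear coding and each server compresses its composite bits. -/
theorem exists_isDecodable {n : ℕ} (A B D : Fin n → Finset (Fin n)) (H : Finset (Fin n))
    (hB : ∀ j, B j ⊆ A j) (hD : ∀ j ∈ H, j ∈ D j)
    (t : Fin n → ℕ) (u : Server n → ℕ) (m : Finset (Fin n) → Server n → ℕ)
    (h0 : ∀ j ∉ H, t j = 0) (hm : ∀ K (J : Server n), ¬ K ⊆ J.1 → m K J = 0)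
    (hu : ∀ j ∈ H, ∀ J, ∑ K with ¬ K ⊆ A j, m K J = 0 ∨
      ∑ K with ¬ K ⊆ A j, m K J + n ≤ u J)
    (ht : ∀ j ∈ H, ∀ L ⊆ D j \ B j, L.Nonempty → (∀ i ∈ L, 0 < t i) →
      ∑ i ∈ L, t i + 2 * n ≤ ∑ K ∈ (D j ∪ B j).powerset with (K ∩ L).Nonempty, ∑ J, m K J) :
    ∃ f : (J : Server n) → ((i : Fin n) → Fin (t i) → ZMod 2) → Fin (u J) → ZMod 2,
      IsDecodable A f := by
  classical
  obtain ⟨M, hM⟩ := exists_compositeCode H B D t m ht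
  have hlink : ∀ J, ∃ N : Fin (u J) → (Σ K, Fin (m K J)) → ZMod 2, ∀ j ∈ H,
      ∀ v : (Σ K, Fin (m K J)) → ZMod 2, (∀ y, v y ≠ 0 → ¬ y.1 ⊆ A j) →
        (∀ b, ∑ y, N b y * v y = 0) → v = 0 := by
    intro J
    obtain ⟨N, hN⟩ := exists_linkCode (X := Σ K, Fin (m K J)) H (fun j => {y | ¬ y.1 ⊆ A j}) (u J)
      (fun j hj => by
        rw [card_filter_sigma_fin (fun K => m K J) (fun K => ¬ K ⊆ A j)]
        exact hu j hj J)
    exact ⟨N, fun j hj v hv => hN j hj v fun y hy => by simpa using hv y hy⟩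
  choose N hN using hlink
  let w : ((i : Fin n) → Fin (t i) → ZMod 2) →
      (Σ p : Finset (Fin n) × Server n, Fin (m p.1 p.2)) → ZMod 2 :=
    fun x e => ∑ y with y.1 ∈ e.1.1, M e y * x y.1 y.2
  have hw : ∀ x x' e, (∀ i ∈ e.1.1, x i = x' i) → w x e = w x' e := by
    intro x x' e h
    refine sum_congr rfl fun y hy => ?_
    rw [h y.1 (mem_filter.mp hy).2]
  have hsub : ∀ x x' e, w (x - x') e = w x e - w x' e := by
    intro x x' e
    simp only [w, ← sum_sub_distrib, Pi.sub_apply, mul_sub]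
  refine ⟨fun J x b => ∑ y, N J b y * w x ⟨(y.1, J), y.2⟩, ?_, ?_⟩
  · intro J x x' h
    funext b
    refine sum_congr rfl fun y _ => ?_
    have hK : y.1 ⊆ J.1 := by
      by_contra hK
      have := y.2.pos
      rw [hm _ _ hK] at this
      exact this.false
    rw [hw x x' _ fun i hi => h i (hK hi)]
  · intro x x' j hA hf
    by_cases hj : j ∈ H
    swap
    · funext b
      have := b.pos
      rw [h0 j hj] at this
      exact this.false.elim
    have hz : ∀ i ∈ A j, (x - x') i = 0 := fun i hi => by simp [hA i hi]
    -- The difference of the messages has zero composite bits for `K ⊆ A j`; the link code forces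
    -- the remaining ones to vanish too, at every server.
    have hw0 : ∀ K J (b : Fin (m K J)), w (x - x') ⟨(K, J), b⟩ = 0 := by
      intro K J b
      have := hN J j hj (fun y => w (x - x') ⟨(y.1, J), y.2⟩)
        (fun y hy hK => hy (by
          rw [hw (x - x') 0 _ fun i hi => by simpa using hz i (hK hi)]
          simp [w]))
        (fun b => by
          simp only [hsub, mul_sub, sum_sub_distrib]
          exact sub_eq_zero.mpr (congrFun (hf J) b))
      exact congrFun this ⟨K, b⟩
    have := hM j hj (x - x') (fun i hi => hz i (hB j hi)) (fun e _ => hw0 e.1.1 e.1.2 e.2) j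
      (hD j hj)
    exact sub_eq_zero.mp this

open Filter

/-! ### Group regions and rounding of rates -/

theorem held_singleton {n : ℕ} (J : Server n) : held {J} = J.1 := by simp [held]

theorem groupSide_subset {n : ℕ} (S : Finset (Fin n)) (P : Finset (Server n)) :
    groupSide S P ⊆ S :=
  biUnion_subset.mpr fun _ _ => inter_subset_left

theorem held_univ (n : ℕ) : held (univ : Finset (Server n)) = univ := by
  ext i
  simp only [held, mem_biUnion, mem_univ, true_and, iff_true]
  exact ⟨⟨{i}, singleton_nonempty i⟩, mem_singleton_self i⟩

theorem groupSide_univ {n : ℕ} (S : Finset (Fin n)) :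
    groupSide S (univ : Finset (Server n)) = S := by
  refine (groupSide_subset S univ).antisymm fun i hi => ?_
  simp only [groupSide, mem_biUnion, mem_univ, true_and]
  exact ⟨⟨{i}, singleton_nonempty i⟩, mem_inter.mpr ⟨hi, mem_singleton_self i⟩⟩

theorem mem_groupRegion_iff {n : ℕ} {A : Fin n → Finset (Fin n)} {C : Server n → ℝ}
    {P : Finset (Server n)} {R : Fin n → ℝ} :
    R ∈ groupRegion A C P ↔ ∃ c : Finset (Fin n) → Server n → ℝ,
      (∀ J ∈ P, ∀ K ⊆ J.1, K.Nonempty → 0 ≤ c K J) ∧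
      (∀ j ∈ held P, ∀ J ∈ P, ∑ K ∈ J.1.powerset with ¬ K ⊆ A j, c K J ≤ C J) ∧
      (∀ j, j ∉ held P → R j = 0) ∧
      ∀ j ∈ held P, ∃ D, (D ⊆ held P ∧ j ∈ D) ∧ R ∈ groupPoly P c D (groupSide (A j) P) := by
  simp only [groupRegion, Set.mem_ofPred_eq, Set.mem_iInter, Set.mem_iUnion, exists_prop]

/-- Finitely many strict inequalities survive a small reduction of their right-hand sides. -/
theorem exists_lt_one_mul {ι : Type*} [Finite ι] (p : ι → Prop) (a b : ι → ℝ)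
    (h : ∀ i, p i → a i < b i) : ∃ δ : ℝ, 0 < δ ∧ δ < 1 ∧ ∀ i, p i → a i < δ * b i := by
  have h1 : ∀ᶠ δ : ℝ in nhdsWithin 1 (Set.Iio 1), ∀ i, p i → a i < δ * b i := by
    rw [eventually_all]
    intro i
    by_cases hi : p i
    swap
    · exact Eventually.of_forall fun _ h => absurd h hi
    have : ContinuousAt (fun δ : ℝ => δ * b i) 1 := by fun_prop
    have h1 := this.eventually (lt_mem_nhds (by simpa using h i hi))
    exact (h1.filter_mono nhdsWithin_le_nhds).mono fun _ h _ => h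
  have h2 : ∀ᶠ δ : ℝ in nhdsWithin 1 (Set.Iio 1), 0 < δ :=
    Filter.Eventually.filter_mono nhdsWithin_le_nhds (lt_mem_nhds one_pos)
  obtain ⟨δ, ha, hb, hc⟩ := (h1.and (h2.and self_mem_nhdsWithin)).exists
  exact ⟨δ, hb, hc, ha⟩

theorem eventually_mul_add_le {a b : ℝ} (h : a < b) (k : ℝ) :
    ∀ᶠ r : ℕ in atTop, (r : ℝ) * a + k ≤ r * b := by
  filter_upwards [(tendsto_natCast_atTop_atTop (R := ℝ)).eventually_ge_atTop (k / (b - a))]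
    with r hr
  rw [div_le_iff₀ (sub_pos.mpr h)] at hr
  linarith

/-- The number of bits of the composite message `K` at server `J` when the group `P` uses the
composite lengths `c`. -/
noncomputable def compositeLength {n : ℕ} (P : Finset (Server n)) (c : Finset (Fin n) → Server n → ℝ)
    (K : Finset (Fin n)) (J : Server n) : ℕ :=
  open Classical in if J ∈ P ∧ K ⊆ J.1 ∧ K.Nonempty then ⌊c K J⌋₊ else 0

theorem sum_compositeLength_le {n : ℕ} {P : Finset (Server n)}
    {c : Finset (Fin n) → Server n → ℝ} {J : Server n} (hJ : J ∈ P)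
    (hc : ∀ K ⊆ J.1, K.Nonempty → 0 ≤ c K J) (S : Finset (Fin n)) :
    ((∑ K with ¬ K ⊆ S, compositeLength P c K J : ℕ) : ℝ) ≤
      ∑ K ∈ J.1.powerset with ¬ K ⊆ S, c K J := by
  have h : ∑ K with ¬ K ⊆ S, compositeLength P c K J =
      ∑ K ∈ J.1.powerset with ¬ K ⊆ S, compositeLength P c K J := by
    refine (sum_subset (filter_subset_filter _ (subset_univ _)) fun K hK hK' => ?_).symm
    refine if_neg fun h => hK' (mem_filter.mpr ⟨mem_powerset.mpr h.2.1, (mem_filter.mp hK).2⟩)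
  rw [h, Nat.cast_sum]
  refine sum_le_sum fun K hK => ?_
  obtain ⟨hK1, hK2⟩ := mem_filter.mp hK
  rw [mem_powerset] at hK1
  have hne : K.Nonempty := by
    rw [nonempty_iff_ne_empty]
    rintro rfl
    exact hK2 (empty_subset _)
  rw [compositeLength, if_pos ⟨hJ, hK1, hne⟩]
  exact Nat.floor_le (hc K hK1 hne)

/-- Rounding down loses less than one bit for each pair of a composite message and a server of the
group holding it; the sum of ones counts these pairs. -/
theorem le_sum_compositeLength {n : ℕ} (P : Finset (Server n))
    (c : Finset (Fin n) → Server n → ℝ) (Q : Finset (Finset (Fin n)))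
    (hQ : ∀ K ∈ Q, K.Nonempty) :
    ∑ K ∈ Q, ∑ J ∈ P with K ⊆ J.1, c K J - ∑ K ∈ Q, ∑ J ∈ P with K ⊆ J.1, 1 ≤
      ((∑ K ∈ Q, ∑ J, compositeLength P c K J : ℕ) : ℝ) := by
  simp only [← sum_sub_distrib, Nat.cast_sum]
  refine sum_le_sum fun K hK => ?_
  refine (sum_le_sum fun J hJ => ?_).trans
    (sum_le_sum_of_subset_of_nonneg (subset_univ _) fun _ _ _ => Nat.cast_nonneg _)
  obtain ⟨hJ, hKJ⟩ := mem_filter.mp hJ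
  rw [compositeLength, if_pos ⟨hJ, hKJ, hQ K hK⟩]
  exact (Nat.sub_one_lt_floor _).le

/-- Rate tuples in the composite coding region of a group are achieved, for all large block
lengths, by codes in which only the servers of the group transmit. -/
theorem eventually_exists_isDecodable {n : ℕ} {A : Fin n → Finset (Fin n)} {C : Server n → ℝ}
    (hC : ∀ J, 0 ≤ C J) {P : Finset (Server n)} {R : Fin n → ℝ} (hR : R ∈ groupRegion A C P) :
    ∀ᶠ r : ℕ in atTop, ∃ (t : Fin n → ℕ) (u : Server n → ℕ),
      (∀ j, (r : ℝ) * R j ≤ t j) ∧ (∀ J ∈ P, (u J : ℝ) ≤ r * C J) ∧ (∀ J ∉ P, u J = 0) ∧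
      ∃ f : (J : Server n) → ((i : Fin n) → Fin (t i) → ZMod 2) → Fin (u J) → ZMod 2,
        IsDecodable A f := by
  obtain ⟨c, hc0, hcC, hR0, hD⟩ := mem_groupRegion_iff.mp hR
  choose! D hD hDR using hD
  let B : Fin n → Finset (Fin n) := fun j => groupSide (A j) P
  let Q : Fin n → Finset (Fin n) → Finset (Finset (Fin n)) := fun j L =>
    {K ∈ (D j ∪ B j).powerset | (K ∩ L).Nonempty}
  have hpoly : ∀ q : Fin n × Finset (Fin n),
      (q.1 ∈ held P ∧ q.2 ⊆ D q.1 \ B q.1 ∧ q.2.Nonempty) →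
        ∑ i ∈ q.2, R i < ∑ K ∈ Q q.1 q.2, ∑ J ∈ P with K ⊆ J.1, c K J :=
    fun q hq => hDR q.1 hq.1 q.2 hq.2.1 hq.2.2
  obtain ⟨δ, hδ0, hδ1, hδ⟩ := exists_lt_one_mul _ _ _ hpoly
  -- The added constants are the losses from rounding the rates up, the slack of
  -- `exists_compositeCode`, and the loss from rounding composite lengths down.
  have hlarge : ∀ᶠ r : ℕ in atTop, ∀ (j : Fin n) (L : Finset (Fin n)),
      j ∈ held P ∧ L ⊆ D j \ B j ∧ L.Nonempty → (r : ℝ) * ∑ i ∈ L, R i +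
        (∑ _i ∈ L, 1 + 2 * n + ∑ K ∈ Q j L, ∑ J ∈ P with K ⊆ J.1, 1) ≤
          r * (δ * ∑ K ∈ Q j L, ∑ J ∈ P with K ⊆ J.1, c K J) := by
    refine eventually_all.mpr fun j => eventually_all.mpr fun L => ?_
    by_cases hq : j ∈ held P ∧ L ⊆ D j \ B j ∧ L.Nonempty
    · exact (eventually_mul_add_le (hδ (j, L) hq) _).mono fun _ h _ => h
    · exact Eventually.of_forall fun _ h => absurd h hq
  -- Scaling by `δ` frees room for the `n` extra bits only on links of positive capacity. On the
  -- others the composite bits unknown to a receiver have total length zero.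
  have hlink : ∀ᶠ r : ℕ in atTop, ∀ J : {J : Server n // 0 < C J},
      (r : ℝ) * (δ * C J) + (n + 1) ≤ r * C J :=
    eventually_all.mpr fun J => eventually_mul_add_le (by nlinarith [J.2]) _
  filter_upwards [hlarge, hlink] with r hr1 hr2
  let c' : Finset (Fin n) → Server n → ℝ := fun K J => r * (δ * c K J)
  refine ⟨fun i => ⌈(r : ℝ) * R i⌉₊, fun J => if J ∈ P then ⌊(r : ℝ) * C J⌋₊ else 0,
    fun j => Nat.le_ceil _, fun J hJ => ?_, fun J hJ => if_neg hJ, ?_⟩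
  · dsimp only
    rw [if_pos hJ]
    exact Nat.floor_le (mul_nonneg r.cast_nonneg (hC J))
  refine exists_isDecodable A B D (held P) (fun j => groupSide_subset _ _)
    (fun j hj => (hD j hj).2) _ _ (compositeLength P c') (fun j hj => by simp [hR0 j hj])
    (fun K J hK => if_neg fun h => hK h.2.1) ?_ ?_
  · intro j hj J
    by_cases hJ : J ∈ P
    swap
    · exact Or.inl (sum_eq_zero fun K _ => if_neg fun h => hJ h.1)
    have hle : ((∑ K with ¬ K ⊆ A j, compositeLength P c' K J : ℕ) : ℝ) ≤ r * (δ * C J) := by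
      refine (sum_compositeLength_le hJ (fun K hK hne => ?_) (A j)).trans ?_
      · have := hc0 J hJ K hK hne
        positivity
      · simp only [c', ← mul_sum]
        have := hcC j hj J hJ
        gcongr
    rcases (hC J).eq_or_lt with h0 | hpos
    · left
      rw [← h0, mul_zero, mul_zero] at hle
      exact_mod_cast le_antisymm hle (Nat.cast_nonneg _)
    · right
      rw [if_pos hJ]
      refine Nat.le_floor ?_
      have := hr2 ⟨J, hpos⟩
      push_cast at this hle ⊢
      linarith
  · intro j hj L hL hne hpos
    have hr := hr1 j L ⟨hj, hL, hne⟩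
    -- For a very negative rate the natural-number ceiling is 0, which may exceed the rate plus one.
    -- Hence only sets `L` of messages of positive length are considered.
    have h1 : ((∑ i ∈ L, ⌈(r : ℝ) * R i⌉₊ : ℕ) : ℝ) ≤ r * ∑ i ∈ L, R i + ∑ _i ∈ L, 1 := by
      rw [Nat.cast_sum, mul_sum, ← sum_add_distrib]
      exact sum_le_sum fun i hi => (Nat.ceil_lt_add_one (Nat.ceil_pos.mp (hpos i hi)).le).le
    have h2 := le_sum_compositeLength P c' (Q j L)
      fun K hK => (mem_filter.mp hK).2.mono inter_subset_left
    have h2' : ∑ K ∈ Q j L, ∑ J ∈ P with K ⊆ J.1, c' K J =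
        r * (δ * ∑ K ∈ Q j L, ∑ J ∈ P with K ⊆ J.1, c K J) := by
      simp only [c', mul_sum]
    rw [h2'] at h2
    have h3 : ((∑ i ∈ L, ⌈(r : ℝ) * R i⌉₊ + 2 * n : ℕ) : ℝ) ≤
        ((∑ K ∈ Q j L, ∑ J, compositeLength P c' K J : ℕ) : ℝ) := by
      push_cast at h1 h2 ⊢
      linarith
    exact_mod_cast h3

/-! ### Concatenating the codes of the groups -/

theorem achievable_of_mem_groupInnerBound {n : ℕ} {A : Fin n → Finset (Fin n)}
    {C : Server n → ℝ} (hC : ∀ J, 0 ≤ C J) {G : Finset (Finset (Server n))}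
    (hG : ∀ P ∈ G, ∀ Q ∈ G, P ≠ Q → Disjoint P Q) {R : Fin n → ℝ}
    (hR : R ∈ groupInnerBound A C G) : Achievable A C R := by
  classical
  obtain ⟨ρ, hρ, rfl⟩ := hR
  -- Each group's code exists for all large block lengths, so finitely many groups share one.
  have hev : ∀ᶠ r : ℕ in atTop, ∀ P : G, _ :=
    eventually_all.mpr fun P => eventually_exists_isDecodable hC (hρ P.1 P.2)
  obtain ⟨r, hr, hpos⟩ := (hev.and (eventually_gt_atTop 0)).exists
  choose t u ht hu hu0 f hf using hr
  have hrpos : (0 : ℝ) < r := by exact_mod_cast hpos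
  refine ⟨r, fun i => ∑ P : G, t P i, fun J => ∑ P : G, u P J, hpos, ?_, fun j => ?_, fun J => ?_⟩
  · refine IsDecodable.nonempty_indexCode (A := A) (T := fun i => Σ P : G, Fin (t P i))
      (U := fun J => Σ P : G, Fin (u P J))
      (f := fun J x b => f b.1 J (fun i a => x i ⟨b.1, a⟩) b.2) ⟨?_, ?_⟩
      (fun i => Fintype.equivFinOfCardEq (by simp)) (fun J => Fintype.equivFinOfCardEq (by simp))
    · intro J x x' h
      funext b
      have := (hf b.1).eq_of_agree J (fun i a => x i ⟨b.1, a⟩) (fun i a => x' i ⟨b.1, a⟩)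
        fun i hi => by rw [h i hi]
      exact congrFun this b.2
    · intro x x' j hA h
      funext ⟨P, a⟩
      have := (hf P).determines (fun i a => x i ⟨P, a⟩) (fun i a => x' i ⟨P, a⟩) j
        (fun i hi => by rw [hA i hi]) fun J => funext fun b => congrFun (h J) ⟨P, b⟩
      exact congrFun this a
  · rw [le_div_iff₀ hrpos, mul_comm, Finset.sum_apply, ← sum_coe_sort G, mul_sum, Nat.cast_sum]
    exact sum_le_sum fun P _ => ht P j
  · rw [div_le_iff₀ hrpos, mul_comm (C J)]
    dsimp only
    -- By disjointness at most one group contains `J`, and the codes of the others leave its link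
    -- silent.
    by_cases h : ∃ P : G, J ∈ P.1
    · obtain ⟨P, hP⟩ := h
      rw [sum_eq_single P (fun Q _ hQ => hu0 Q J fun hJ => ?_) (by simp)]
      · exact hu P J hP
      · exact disjoint_left.mp (hG Q.1 Q.2 P.1 P.2 fun h => hQ (Subtype.ext h)) hJ hP
    · push Not at h
      rw [sum_eq_zero fun P _ => hu0 P J (h P), Nat.cast_zero]
      exact mul_nonneg hrpos.le (hC J)

/-! ### The two extreme groupings -/

/-- Under `h` every composite message in the sum is held by `J`, so the inner sum over servers has
exactly one term. -/
theorem groupPoly_singleton {n : ℕ} (J : Server n) (c : Finset (Fin n) → Server n → ℝ)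
    {D S : Finset (Fin n)} (h : D ∪ S ⊆ J.1) :
    groupPoly {J} c D S = serverPoly (fun K => c K J) D S := by
  have : ∀ L : Finset (Fin n), ∑ K ∈ (D ∪ S).powerset with (K ∩ L).Nonempty,
      ∑ J' ∈ ({J} : Finset (Server n)) with K ⊆ J'.1, c K J' =
      ∑ K ∈ (D ∪ S).powerset with (K ∩ L).Nonempty, c K J := by
    refine fun L => sum_congr rfl fun K hK => ?_
    have hK : K ⊆ J.1 := (mem_powerset.mp (mem_filter.mp hK).1).trans h
    simp [filter_singleton, hK]
  simp only [groupPoly, serverPoly, this]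

theorem groupRegion_singleton {n : ℕ} (A : Fin n → Finset (Fin n)) (C : Server n → ℝ)
    (J : Server n) : groupRegion A C {J} = serverRegion A C J := by
  have hside : ∀ j, groupSide (A j) {J} = A j ∩ J.1 := fun j => by simp [groupSide]
  ext R
  simp only [mem_groupRegion_iff, serverRegion, Set.mem_ofPred_eq, Set.mem_iInter, Set.mem_iUnion,
    exists_prop, held_singleton, hside, mem_singleton, forall_eq]
  constructor
  · rintro ⟨c, h1, h2, h3, h4⟩
    refine ⟨fun K => c K J, h1, h2, h3, fun j hj => ?_⟩
    obtain ⟨D, hD, hR⟩ := h4 j hj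
    exact ⟨D, hD, groupPoly_singleton J c (union_subset hD.1 inter_subset_right) ▸ hR⟩
  · rintro ⟨c, h1, h2, h3, h4⟩
    refine ⟨fun K _ => c K, h1, h2, h3, fun j hj => ?_⟩
    obtain ⟨D, hD, hR⟩ := h4 j hj
    refine ⟨D, hD, ?_⟩
    rwa [groupPoly_singleton J _ (union_subset hD.1 inter_subset_right)]

theorem groupInnerBound_singletonGroups {n : ℕ} (A : Fin n → Finset (Fin n))
    (C : Server n → ℝ) :
    groupInnerBound A C (singletonGroups n) = separateInnerBound A C := by
  classical
  have hinj : Function.Injective fun J : Server n => ({J} : Finset (Server n)) :=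
    singleton_injective
  ext R
  constructor
  · rintro ⟨ρ, hρ, rfl⟩
    refine ⟨fun J => ρ {J}, fun J => ?_, ?_⟩
    · rw [← groupRegion_singleton]
      exact hρ _ (mem_image_of_mem _ (mem_univ J))
    · rw [singletonGroups, sum_image hinj.injOn]
  · rintro ⟨ρ, hρ, rfl⟩
    -- Summing `ρ` over the group extends it to all sets of servers and returns `ρ J` at `{J}`.
    refine ⟨fun P => ∑ J ∈ P, ρ J, fun P hP => ?_, ?_⟩
    · obtain ⟨J, -, rfl⟩ := mem_image.mp hP
      dsimp only
      rw [groupRegion_singleton, sum_singleton]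
      exact hρ J
    · rw [singletonGroups, sum_image hinj.injOn]
      simp

theorem groupInnerBound_oneGroup {n : ℕ} (A : Fin n → Finset (Fin n)) (C : Server n → ℝ) :
    groupInnerBound A C (oneGroup n) = commonInnerBound A C := by
  have h : groupInnerBound A C (oneGroup n) = groupRegion A C univ := by
    ext R
    constructor
    · rintro ⟨ρ, hρ, rfl⟩
      simpa [oneGroup] using hρ
    · intro hR
      exact ⟨fun _ => R, by simpa [oneGroup] using hR, by simp [oneGroup]⟩
  rw [h]
  ext R
  simp only [mem_groupRegion_iff, commonInnerBound, groupPoly, commonPoly, Set.mem_ofPred_eq,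
    Set.mem_iInter, Set.mem_iUnion, exists_prop, held_univ, groupSide_univ, mem_univ,
    subset_univ, true_imp_iff, true_and, not_true_eq_false, IsEmpty.forall_iff, implies_true]

end DistIndexCoding

theorem mainTheorem4 {n : ℕ} (A : Fin n → Finset (Fin n)) (hA : ∀ j, j ∉ A j)
    (C : DistIndexCoding.Server n → ℝ) (hC : ∀ J, 0 ≤ C J) :
    (∀ G : Finset (Finset (DistIndexCoding.Server n)),
      (∀ P ∈ G, ∀ Q ∈ G, P ≠ Q → Disjoint P Q) →
        (∀ R ∈ DistIndexCoding.groupInnerBound A C G, DistIndexCoding.Achievable A C R) ∧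
        closure (DistIndexCoding.groupInnerBound A C G) ⊆
          DistIndexCoding.capacityRegion A C) ∧
    DistIndexCoding.groupInnerBound A C (DistIndexCoding.singletonGroups n) =
      DistIndexCoding.separateInnerBound A C ∧
    DistIndexCoding.groupInnerBound A C (DistIndexCoding.oneGroup n) =
      DistIndexCoding.commonInnerBound A C := by
  have key : ∀ G : Finset (Finset (DistIndexCoding.Server n)),
      (∀ P ∈ G, ∀ Q ∈ G, P ≠ Q → Disjoint P Q) →
        ∀ R ∈ DistIndexCoding.groupInnerBound A C G, DistIndexCoding.Achievable A C R :=
    fun _ hG _ hR => DistIndexCoding.achievable_of_mem_groupInnerBound hC hG hR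
  exact ⟨fun G hG => ⟨key G hG, closure_mono (key G hG)⟩,
    DistIndexCoding.groupInnerBound_singletonGroups A C,
    DistIndexCoding.groupInnerBound_oneGroup A C⟩
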